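/- Let $n\ge 1$ and let $\ell_\infty$ be the complex Banach space of bounded sequences $(x_i)_{i\in\mathbb N}$ of complex numbers with the supremum norm. Let $P:\ell_\infty\to\mathbb C$ be a continuous $n$-homogeneous polynomial, that is, there is a symmetric $n$-linear form $A:\ell_\infty\times\cdots\times\ell_\infty\to\mathbb C$ with $P(x)=A(x,\ldots,x)$ for every $x\in\ell_\infty$, and there is a constant $k$ with $|P(x)|\le k\|x\|^n$ for every $x\in\ell_\infty$. Then there is a linear subspace $H\subset \ell_\infty$ such that $P(x)=0$ for every $x\in H$ and $H$ is isomorphic to $\ell_\infty$ (there is a linear homeomorphism of $\ell_\infty$ onto $H$). In particular, $H$ is not separable. -/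

import Mathlib

open scoped ENNReal

/-- `P : X → ℂ` is a continuous `n`-homogeneous polynomial on the complex normed space `X`: it is
the diagonal of a symmetric `n`-linear form, and `|P x| ≤ k ‖x‖ ^ n` for some constant `k`. -/
def IsContHomogeneousPolynomial {X : Type*} [NormedAddCommGroup X] [NormedSpace ℂ X]
    (n : ℕ) (P : X → ℂ) : Prop :=
  (∃ A : MultilinearMap ℂ (fun _ : Fin n => X) ℂ,
    (∀ (σ : Equiv.Perm (Fin n)) (v : Fin n → X), A (fun i => v (σ i)) = A v) ∧
    ∀ x : X, P x = A (fun _ => x)) ∧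
  ∃ k : ℝ, ∀ x : X, ‖P x‖ ≤ k * ‖x‖ ^ n

/-- The complex Banach space `l_∞` of bounded sequences with the supremum norm. -/
abbrev LInfty : Type := lp (fun _ : ℕ => ℂ) ∞

/-!
A finite family of homogeneous polynomials in more variables than polynomials has a common nonzero
zero: otherwise some maximal ideal would be minimal over fewer generators than its height, against
Krull's theorem. Hence disjoint finite blocks `u₀, u₁, …` can be chosen one after the other so that
the `n`-linear form `A` vanishes at all tuples of blocks. By polarization `A` is bounded, and the
closed span of the `u k` in the product topology is an isometric copy of `ℓ∞`, so one may assume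
that `A` vanishes at all tuples of unit vectors.

Such a form vanishes on `ℓ∞(M)` for some infinite `M`. By induction on the number of slots, applied
to the countably many forms obtained by fixing one slot at a unit vector, `A` vanishes on `ℓ∞(M)` as
soon as one slot is finitely supported. If `A ≠ 0` at `v t` in the unit ball of `ℓ∞(N t)` for each
`t` in an almost disjoint family, finite truncation makes the `v t` disjoint, and the parallelogram
law supplies unimodular coefficients with `∑ |A (v t)|² ≤ |A (∑ θ t • v t)|² ≤ ‖A‖²`. Thus only
countably many members of an uncountable almost disjoint family are bad.
-/

section CommonZeros

open MvPolynomial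

variable {K σ : Type*} [Field K] [IsAlgClosed K] [Finite σ]

theorem exists_lt_height_vanishingIdeal_singleton {N : ℕ} (hN : N < Nat.card σ) :
    ∃ x : σ → K, (N : ℕ∞) < (vanishingIdeal K {x}).height := by
  have hdim : ¬ ringKrullDim (MvPolynomial σ K) ≤ N := by
    rw [ringKrullDim_of_isNoetherianRing, ringKrullDim_eq_zero_of_field, zero_add, not_le]
    exact_mod_cast hN
  rw [ringKrullDim_le_iff_isMaximal_height_le] at hdim
  push Not at hdim
  obtain ⟨m, hm, hlt⟩ := hdim
  obtain ⟨x, rfl⟩ := isMaximal_iff_eq_vanishingIdeal_singleton.1 hm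
  exact ⟨x, by exact_mod_cast hlt⟩

theorem height_vanishingIdeal_singleton_le {ι : Type*} [Finite ι]
    {p : ι → MvPolynomial σ K} {x : σ → K}
    (hp : zeroLocus K (Ideal.span (Set.range p)) = {x}) :
    (vanishingIdeal K {x}).height ≤ Nat.card ι := by
  have hrad : vanishingIdeal K {x} = (Ideal.span (Set.range p)).radical := by
    rw [← hp, vanishingIdeal_zeroLocus_eq_radical]
  have hprime : (vanishingIdeal K {x}).IsPrime :=
    (isMaximal_iff_eq_vanishingIdeal_singleton.2 ⟨x, rfl⟩).isPrime
  have hmin : vanishingIdeal K {x} ∈ (Ideal.span (Set.range p)).minimalPrimes := by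
    rw [← Ideal.radical_minimalPrimes, ← hrad, Ideal.minimalPrimes_eq_subsingleton_self]
    rfl
  calc (vanishingIdeal K {x}).height ≤ (Set.range p).ncard :=
        Ideal.height_le_card_of_mem_minimalPrimes_span (Set.finite_range p) hmin
    _ ≤ Nat.card ι := by
        rw [← Nat.card_coe_set_eq]
        exact_mod_cast Finite.card_range_le p

theorem exists_ne_zero_forall_eval_eq_zero {ι : Type*} [Finite ι]
    (hcard : Nat.card ι < Nat.card σ) (p : ι → MvPolynomial σ K)
    (hp : ∀ i, eval 0 (p i) = 0) :
    ∃ a : σ → K, a ≠ 0 ∧ ∀ i, eval a (p i) = 0 := by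
  obtain ⟨x, hx⟩ := exists_lt_height_vanishingIdeal_singleton (K := K) hcard
  -- Translating the common zero `0` to `x` makes it a point whose ideal has the full height.
  let q : ι → MvPolynomial σ K := fun i => bind₁ (fun j => X j - C (x j)) (p i)
  have aeval_q (y : σ → K) (i : ι) : aeval y (q i) = eval (y - x) (p i) := by
    simp only [q, aeval_bind₁, map_sub, aeval_X, aeval_C]
    rfl
  by_contra! H
  refine hx.not_ge (height_vanishingIdeal_singleton_le (p := q) (Set.ext fun y => ?_))
  rw [zeroLocus_span]
  simp only [Set.mem_ofPred_eq, Set.forall_mem_range, Set.mem_singleton_iff, aeval_q]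
  refine ⟨fun h => ?_, fun h i => by rw [h, sub_self, hp]⟩
  by_contra hne
  obtain ⟨i, hi⟩ := H (y - x) (sub_ne_zero.2 hne)
  exact hi (h i)

end CommonZeros

theorem exists_mvPolynomial_eval_eq_map_const {K ι κ V : Type*} [CommRing K] [Finite ι] [Fintype κ]
    [AddCommGroup V] [Module K V] (B : MultilinearMap K (fun _ : ι => V) K) (b : κ → V) :
    ∃ p : MvPolynomial κ K, ∀ a, MvPolynomial.eval a p = B fun _ => ∑ k, a k • b k := by
  classical
  have := Fintype.ofFinite ι
  refine ⟨∑ r : ι → κ, (∏ i, MvPolynomial.X (r i)) * MvPolynomial.C (B fun i => b (r i)),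
    fun a => ?_⟩
  rw [B.map_sum]
  simp [map_prod, B.map_smul_univ]

theorem exists_ne_zero_forall_map_const_eq_zero {K V R : Type*} [Field K] [IsAlgClosed K]
    [AddCommGroup V] [Module K V] [Finite R] (hR : Nat.card R < Module.finrank K V)
    {ι : R → Type*} [∀ r, Finite (ι r)] [∀ r, Nonempty (ι r)]
    (B : ∀ r, MultilinearMap K (fun _ : ι r => V) K) :
    ∃ u : V, u ≠ 0 ∧ ∀ r, B r (fun _ => u) = 0 := by
  have := Module.finite_of_finrank_pos (Nat.zero_lt_of_lt hR)
  let b := Module.finBasis K V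
  choose p hp using fun r => exists_mvPolynomial_eval_eq_map_const (B r) b
  obtain ⟨a, ha, hpa⟩ := exists_ne_zero_forall_eval_eq_zero (by simpa using hR) p fun r => by
    rw [hp]
    exact (B r).map_coord_zero (Classical.arbitrary _) (by simp)
  refine ⟨b.equivFun.symm a, b.equivFun.symm.map_ne_zero_iff.2 ha, fun r => ?_⟩
  rw [b.equivFun_symm_apply, ← hp, hpa]

theorem exists_disjoint_support_forall_map_eq_zero {K ι : Type*} [Field K] [IsAlgClosed K]
    [Finite ι] (A : MultilinearMap K (fun _ : ι => ℕ →₀ K) K) (U : Finset (ℕ →₀ K)) :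
    ∃ u : ℕ →₀ K, u ≠ 0 ∧ (∀ x ∈ U, Disjoint x.support u.support) ∧
      ∀ v : ι → ℕ →₀ K, (∀ i, v i = u ∨ v i ∈ U) → (∃ i, v i = u) → A v = 0 := by
  classical
  -- The slots in `S` receive `u`, the remaining ones receive elements of `U`.
  let R := Σ S : {S : Set ι // S.Nonempty}, {i // i ∉ S.1} → U
  obtain ⟨D, hD, hcard⟩ :=
    (U.biUnion Finsupp.support).finite_toSet.infinite_compl.exists_subset_card_eq (Nat.card R + 1)
  let W := Finsupp.supported K K (D : Set ℕ)
  have hW : Module.finrank K W = Nat.card R + 1 := by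
    rw [(Finsupp.supportedEquivFinsupp (D : Set ℕ)).finrank_eq, Module.finrank_finsupp_self]
    exact (Fintype.card_coe D).trans hcard
  have (r : R) : Nonempty r.1.1 := r.1.2.to_subtype
  obtain ⟨⟨u, huW⟩, hu, hB⟩ := exists_ne_zero_forall_map_const_eq_zero (V := W) (by omega)
    fun r : R => (A.domDomRestrict (· ∈ r.1.1) fun i => (r.2 i : ℕ →₀ K)).compLinearMap
      fun _ => W.subtype
  refine ⟨u, by simpa using hu, fun x hx => ?_, fun v hv hex => ?_⟩
  · rw [Finset.disjoint_right]
    intro m hm hmx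
    exact hD (huW hm) (Finset.mem_coe.2 (Finset.mem_biUnion.2 ⟨x, hx, hmx⟩))
  · have := hB ⟨⟨{i | v i = u}, hex⟩, fun i => ⟨v i, (hv i).resolve_left i.2⟩⟩
    rw [MultilinearMap.compLinearMap_apply, MultilinearMap.domDomRestrict_apply] at this
    convert this using 2
    ext1 i
    by_cases h : v i = u <;> simp [h]

theorem exists_pairwise_disjoint_support_forall_map_eq_zero {K ι : Type*} [Field K]
    [IsAlgClosed K] [Finite ι] [Nonempty ι] (A : MultilinearMap K (fun _ : ι => ℕ →₀ K) K) :
    ∃ u : ℕ → ℕ →₀ K, (∀ k, u k ≠ 0) ∧ (Pairwise fun k l => Disjoint (u k).support (u l).support) ∧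
      ∀ r : ι → ℕ, A (fun i => u (r i)) = 0 := by
  classical
  choose next hne hdisj hA using exists_disjoint_support_forall_map_eq_zero A
  obtain ⟨f, hf, hlt⟩ := exists_seq_of_forall_finset_exists
    (fun p : Finset (ℕ →₀ K) × (ℕ →₀ K) => p.2 = next p.1) (fun p q => p.2 ∈ q.1)
    fun s _ => ⟨(s.image Prod.snd, next (s.image Prod.snd)), rfl,
      fun p hp => Finset.mem_image_of_mem _ hp⟩
  have hdisj_of_lt {k l : ℕ} (h : k < l) : Disjoint (f k).2.support (f l).2.support := by
    rw [hf l]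
    exact hdisj _ _ (hlt k l h)
  refine ⟨fun k => (f k).2, fun k => ?_, fun k l hkl => ?_, fun r => ?_⟩
  · simpa only [hf k] using hne _
  · exact hkl.lt_or_gt.elim hdisj_of_lt fun h => (hdisj_of_lt h).symm
  · obtain ⟨j, hj⟩ := Finite.exists_max r
    refine hA (f (r j)).1 _ (fun i => ?_) ⟨j, hf (r j)⟩
    rcases (hj i).eq_or_lt with h | h
    · exact Or.inl (by simpa only [h] using hf (r j))
    · exact Or.inr (hlt _ _ h)

theorem sum_surjective_eq_sum_perm {ι M : Type*} [Fintype ι] [DecidableEq ι] [AddCommMonoid M]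
    (g : (ι → ι) → M) :
    ∑ r : ι → ι with Function.Surjective r, g r = ∑ σ : Equiv.Perm ι, g σ := by
  refine (Finset.sum_bij (fun (σ : Equiv.Perm ι) _ => (σ : ι → ι)) (fun σ _ => ?_)
    (fun σ _ τ _ h => ?_) (fun r hr => ?_) fun _ _ => rfl).symm
  · simpa using σ.surjective
  · exact DFunLike.coe_injective h
  · exact ⟨.ofBijective r (Finite.surjective_iff_bijective.1 (by simpa using hr)), by simp, rfl⟩

theorem sum_neg_one_pow_card_filter_forall_mem_compl {ι κ : Type*} [Fintype ι] [DecidableEq ι]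
    [Fintype κ] (r : κ → ι) :
    ∑ T : Finset ι with ∀ i, r i ∈ Tᶜ, (-1 : ℤ) ^ T.card =
      if Function.Surjective r then 1 else 0 := by
  have hT : ({T : Finset ι | ∀ i, r i ∈ Tᶜ} : Finset (Finset ι)) =
      (Finset.univ.image r)ᶜ.powerset := by
    ext T
    rw [Finset.mem_powerset, le_compl_comm, Finset.image_subset_iff]
    simp
  rw [hT, Finset.sum_powerset_neg_one_pow_card]
  exact if_congr (by simp [Finset.ext_iff, Function.Surjective]) rfl rfl

theorem sum_neg_one_pow_card_smul_map_sum_compl {R ι V W : Type*} [Semiring R] [Fintype ι]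
    [DecidableEq ι] [AddCommMonoid V] [Module R V] [AddCommGroup W] [Module R W]
    (A : MultilinearMap R (fun _ : ι => V) W)
    (hA : ∀ (σ : Equiv.Perm ι) (v : ι → V), A (fun i => v (σ i)) = A v) (v : ι → V) :
    ∑ T : Finset ι, (-1 : ℤ) ^ T.card • A (fun _ => ∑ i ∈ Tᶜ, v i) =
      (Fintype.card ι).factorial • A v := by
  calc ∑ T : Finset ι, (-1 : ℤ) ^ T.card • A (fun _ => ∑ i ∈ Tᶜ, v i)
      = ∑ T : Finset ι, ∑ r : ι → ι with ∀ i, r i ∈ Tᶜ,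
          (-1 : ℤ) ^ T.card • A (fun i => v (r i)) := by
        refine Finset.sum_congr rfl fun T _ => ?_
        rw [A.map_sum_finset, Finset.smul_sum]
        congr 1
        ext r
        simp
    _ = ∑ r : ι → ι, (∑ T : Finset ι with ∀ i, r i ∈ Tᶜ, (-1 : ℤ) ^ T.card) •
          A (fun i => v (r i)) := by
        simp only [Finset.sum_filter, Finset.sum_smul, ite_smul, zero_smul]
        exact Finset.sum_comm
    _ = ∑ σ : Equiv.Perm ι, A (fun i => v (σ i)) := by
        rw [← sum_surjective_eq_sum_perm fun r => A fun i => v (r i), Finset.sum_filter]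
        simp only [sum_neg_one_pow_card_filter_forall_mem_compl, ite_smul, one_smul, zero_smul]
    _ = (Fintype.card ι).factorial • A v := by
        simp only [hA, Finset.sum_const, Finset.card_univ, Fintype.card_perm]

section Continuity

variable {𝕜 ι V W : Type*} [RCLike 𝕜] [Fintype ι] [NormedAddCommGroup V] [NormedSpace 𝕜 V]
  [NormedAddCommGroup W] [NormedSpace 𝕜 W]

theorem norm_map_le_of_forall_norm_map_const_le (A : MultilinearMap 𝕜 (fun _ : ι => V) W)
    (hA : ∀ (σ : Equiv.Perm ι) (v : ι → V), A (fun i => v (σ i)) = A v) {C : ℝ}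
    (hC : ∀ x, ‖x‖ ≤ Fintype.card ι → ‖A fun _ => x‖ ≤ C) {v : ι → V} (hv : ∀ i, ‖v i‖ ≤ 1) :
    ‖A v‖ ≤ 2 ^ Fintype.card ι * C := by
  classical
  have hnorm (T : Finset ι) : ‖∑ i ∈ Tᶜ, v i‖ ≤ Fintype.card ι := calc
    ‖∑ i ∈ Tᶜ, v i‖ ≤ ∑ i ∈ Tᶜ, 1 := norm_sum_le_of_le _ fun i _ => hv i
    _ ≤ Fintype.card ι := by
      rw [Finset.sum_const, nsmul_one]
      exact_mod_cast Finset.card_le_univ _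
  calc ‖A v‖ ≤ (Fintype.card ι).factorial * ‖A v‖ :=
        le_mul_of_one_le_left (norm_nonneg _) (mod_cast (Fintype.card ι).factorial_pos)
    _ = ‖∑ T : Finset ι, (-1 : ℤ) ^ T.card • A (fun _ => ∑ i ∈ Tᶜ, v i)‖ := by
        rw [sum_neg_one_pow_card_smul_map_sum_compl A hA, RCLike.norm_nsmul 𝕜, nsmul_eq_mul]
    _ ≤ ∑ _T : Finset ι, C := norm_sum_le_of_le _ fun T _ => by
        rcases neg_one_pow_eq_or ℤ T.card with h | h <;> simpa [h] using hC _ (hnorm T)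
    _ = 2 ^ Fintype.card ι * C := by simp

theorem continuous_of_norm_map_const_le (A : MultilinearMap 𝕜 (fun _ : ι => V) W)
    (hA : ∀ (σ : Equiv.Perm ι) (v : ι → V), A (fun i => v (σ i)) = A v) {k : ℝ}
    (hk : ∀ x, ‖A fun _ => x‖ ≤ k * ‖x‖ ^ Fintype.card ι) : Continuous A := by
  set n := Fintype.card ι
  have hball (x : V) (hx : ‖x‖ ≤ n) : ‖A fun _ => x‖ ≤ |k| * n ^ n := calc
    ‖A fun _ => x‖ ≤ k * ‖x‖ ^ n := hk x
    _ ≤ |k| * n ^ n := by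
      gcongr
      exact le_abs_self k
  refine A.continuous_of_bound (2 ^ n * (|k| * n ^ n)) fun v => ?_
  calc ‖A v‖ = ‖A fun i => (‖v i‖ : 𝕜) • ((‖v i‖⁻¹ : ℝ) : 𝕜) • v i‖ := by
        congr 2 with i
        rw [smul_smul, ← RCLike.ofReal_mul]
        rcases eq_or_ne (v i) 0 with h | h
        · rw [h, smul_zero]
        · rw [mul_inv_cancel₀ (norm_ne_zero_iff.2 h), RCLike.ofReal_one, one_smul]
    _ = (∏ i, ‖v i‖) * ‖A fun i => ((‖v i‖⁻¹ : ℝ) : 𝕜) • v i‖ := by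
        rw [A.map_smul_univ, norm_smul, norm_prod]
        simp only [RCLike.norm_ofReal, abs_norm]
    _ ≤ (∏ i, ‖v i‖) * (2 ^ n * (|k| * n ^ n)) := by
        gcongr
        refine norm_map_le_of_forall_norm_map_const_le A hA hball fun i => ?_
        rw [norm_smul, RCLike.norm_ofReal, abs_inv, abs_norm]
        exact inv_mul_le_one
    _ = _ := mul_comm _ _

end Continuity

theorem map_eq_map_of_sub_mem {R ι V W : Type*} [Ring R] [Finite ι] [AddCommGroup V] [Module R V]
    [AddCommGroup W] [Module R W] (B : MultilinearMap R (fun _ : ι => V) W) {S F : Submodule R V}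
    (hB : ∀ v : ι → V, (∀ i, v i ∈ S) → (∃ i, v i ∈ F) → B v = 0) {a b : ι → V}
    (ha : ∀ i, a i ∈ S) (hb : ∀ i, b i ∈ S) (hab : ∀ i, a i - b i ∈ F) : B a = B b := by
  classical
  have := Fintype.ofFinite ι
  have hfix (s : Finset ι) : B (s.piecewise a b) = B b := by
    induction s using Finset.induction_on with
    | empty => rw [Finset.piecewise_empty]
    | insert i s hi ih =>
      have hself : B (s.piecewise a b) = B (Function.update (s.piecewise a b) i (b i)) := by
        rw [← Finset.piecewise_eq_of_notMem s a b hi, Function.update_eq_self]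
      rw [← ih, ← sub_eq_zero, Finset.piecewise_insert, hself, ← B.map_update_sub]
      refine hB _ (fun l => ?_) ⟨i, by rw [Function.update_self]; exact hab i⟩
      rcases eq_or_ne l i with rfl | h
      · rw [Function.update_self]
        exact S.sub_mem (ha l) (hb l)
      · rw [Function.update_of_ne h]
        exact s.piecewise_cases a b (· ∈ S) (ha l) (hb l)
  simpa using hfix Finset.univ

theorem exists_norm_eq_one_sum_norm_sq_le {𝕜 E T : Type*} [RCLike 𝕜] [SeminormedAddCommGroup E]
    [InnerProductSpace 𝕜 E] (J : Finset T) (b : T → E) :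
    ∃ θ : T → 𝕜, (∀ t, ‖θ t‖ = 1) ∧ ∑ t ∈ J, ‖b t‖ ^ 2 ≤ ‖∑ t ∈ J, θ t • b t‖ ^ 2 := by
  classical
  induction J using Finset.induction_on with
  | empty => exact ⟨1, by simp, by simp⟩
  | insert s J hs ih =>
    obtain ⟨θ, hθ, hle⟩ := ih
    set z := ∑ t ∈ J, θ t • b t
    obtain ⟨c, hc, hcz⟩ : ∃ c : 𝕜, ‖c‖ = 1 ∧ ‖z‖ ^ 2 + ‖b s‖ ^ 2 ≤ ‖z + c • b s‖ ^ 2 := by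
      have hpar := parallelogram_law_with_norm 𝕜 z (b s)
      rcases le_total ‖z - b s‖ ‖z + b s‖ with h | h
      · exact ⟨1, by simp, by rw [one_smul]; nlinarith [norm_nonneg (z - b s)]⟩
      · exact ⟨-1, by simp, by
          rw [neg_one_smul, ← sub_eq_add_neg]; nlinarith [norm_nonneg (z + b s)]⟩
    have hz : ∑ t ∈ J, Function.update θ s c t • b t = z := Finset.sum_congr rfl fun t ht => by
      rw [Function.update_of_ne (ne_of_mem_of_not_mem ht hs)]
    refine ⟨Function.update θ s c, fun t => ?_, ?_⟩
    · rcases eq_or_ne t s with rfl | h <;> simp [*]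
    · rw [Finset.sum_insert hs, Finset.sum_insert hs, Function.update_self, hz,
        add_comm (c • b s)]
      calc ‖b s‖ ^ 2 + ∑ t ∈ J, ‖b t‖ ^ 2 ≤ ‖z‖ ^ 2 + ‖b s‖ ^ 2 := by linarith
        _ ≤ ‖z + c • b s‖ ^ 2 := hcz

theorem exists_norm_eq_one_sum_map_norm_sq_le {𝕜 V E T : Type*} [RCLike 𝕜] [AddCommGroup V]
    [Module 𝕜 V] [NormedAddCommGroup E] [InnerProductSpace 𝕜 E] [Fintype T] {n : ℕ}
    (B : MultilinearMap 𝕜 (fun _ : Fin n => V) E) (x : Fin n → T → V) :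
    ∃ θ : Fin n → T → 𝕜, (∀ i t, ‖θ i t‖ = 1) ∧
      ∑ r : Fin n → T, ‖B fun i => x i (r i)‖ ^ 2 ≤ ‖B fun i => ∑ t, θ i t • x i t‖ ^ 2 := by
  induction n with
  | zero =>
    refine ⟨0, fun i => i.elim0, ?_⟩
    rw [Fintype.sum_unique]
    exact (congrArg (‖B ·‖ ^ 2) (Subsingleton.elim _ _)).le
  | succ n ih =>
    let b (t : T) : PiLp 2 fun _ : Fin n → T => E :=
      .toLp 2 fun r => B (Fin.cons (x 0 t) fun i => x i.succ (r i))
    obtain ⟨θ₀, hθ₀, hle₀⟩ := exists_norm_eq_one_sum_norm_sq_le (𝕜 := 𝕜) Finset.univ b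
    obtain ⟨θ, hθ, hle⟩ := ih (B.curryLeft (∑ t, θ₀ t • x 0 t)) fun i => x i.succ
    refine ⟨Fin.cons θ₀ θ, Fin.cases hθ₀ hθ, ?_⟩
    calc ∑ r : Fin (n + 1) → T, ‖B fun i => x i (r i)‖ ^ 2
        = ∑ t, ‖b t‖ ^ 2 := by
          rw [← (Fin.consEquiv fun _ => T).sum_comp, Fintype.sum_prod_type]
          simp only [PiLp.norm_sq_eq_of_L2, b]
          congr! with t _ r _ i
          exact Fin.cases rfl (fun _ => rfl) i
      _ ≤ ‖∑ t, θ₀ t • b t‖ ^ 2 := hle₀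
      _ = ∑ r : Fin n → T, ‖B.curryLeft (∑ t, θ₀ t • x 0 t) fun i => x i.succ (r i)‖ ^ 2 := by
          simp [PiLp.norm_sq_eq_of_L2, b]
      _ ≤ _ := hle
      _ = ‖B fun i => ∑ t, Fin.cons (α := fun _ => T → 𝕜) θ₀ θ i t • x i t‖ ^ 2 := by
          rw [B.curryLeft_apply]
          congr! with i
          exact Fin.cases rfl (fun _ => rfl) i

theorem finite_setOf_floor_mul_eq {x y : ℝ} (hxy : x ≠ y) : {n : ℕ | ⌊n * x⌋ = ⌊n * y⌋}.Finite := by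
  obtain ⟨k, hk⟩ := exists_nat_gt |x - y|⁻¹
  refine (Set.finite_Iio k).subset fun n hn => ?_
  have hpos : 0 < |x - y| := abs_pos.2 (sub_ne_zero.2 hxy)
  have hlt : n * |x - y| < 1 := by
    simpa only [← mul_sub, abs_mul, Nat.abs_cast] using Int.abs_sub_lt_one_of_floor_eq_floor hn
  have : (n : ℝ) < k := ((lt_div_iff₀ hpos).2 hlt).trans (by rwa [one_div])
  exact_mod_cast this

theorem exists_infinite_subset_pairwise_finite_inter {M : Set ℕ} (hM : M.Infinite) :
    ∃ N : ℝ → Set ℕ, (∀ x, N x ⊆ M) ∧ (∀ x, (N x).Infinite) ∧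
      Pairwise fun x y => (N x ∩ N y).Finite := by
  let g : ℕ × ℤ ↪ M := (Encodable.encode' (ℕ × ℤ)).trans (hM.natEmbedding M)
  have hg {p q : ℕ × ℤ} (h : (g p : ℕ) = g q) : p = q := g.injective (Subtype.ext h)
  refine ⟨fun x => Set.range fun n : ℕ => (g (n, ⌊n * x⌋) : ℕ), fun x => ?_, fun x => ?_,
    fun x y hxy => ?_⟩
  · exact Set.range_subset_iff.2 fun n => (g _).2
  · exact Set.infinite_range_of_injective fun m n h => congrArg Prod.fst (hg h)
  · refine ((finite_setOf_floor_mul_eq hxy).image fun n : ℕ => (g (n, ⌊n * x⌋) : ℕ)).subset ?_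
    rintro _ ⟨⟨n, rfl⟩, ⟨m, hm⟩⟩
    obtain ⟨rfl, hfloor⟩ := Prod.ext_iff.1 (hg hm)
    exact ⟨m, hfloor.symm, rfl⟩

theorem exists_forall_ne_apply_eq_zero {ι α R : Type*} [Nonempty ι] [Zero R] {u : ι → α → R}
    (hdisj : Pairwise fun k l => Disjoint (Function.support (u k)) (Function.support (u l)))
    (m : α) : ∃ q, ∀ k, k ≠ q → u k m = 0 := by
  by_contra! H
  obtain ⟨k, -, hk⟩ := H (Classical.arbitrary ι)
  obtain ⟨l, hlk, hl⟩ := H k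
  exact Set.disjoint_left.1 (hdisj hlk) hl hk

namespace LInfty

/-- The inclusion `c₀₀ → ℓ∞` of the finitely supported sequences. -/
noncomputable def ofFinsupp : (ℕ →₀ ℂ) →ₗ[ℂ] LInfty where
  toFun f := ⟨fun m => f m, memℓp_infty (f.finite_range.image norm |>.bddAbove.mono (by
    rintro _ ⟨m, rfl⟩
    exact ⟨f m, Set.mem_range_self m, rfl⟩))⟩
  map_add' _ _ := rfl
  map_smul' _ _ := rfl

theorem ofFinsupp_apply (f : ℕ →₀ ℂ) (m : ℕ) : ofFinsupp f m = f m := rfl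

/-- The `k`-th unit vector of `ℓ∞`. -/
noncomputable def basisVec (k : ℕ) : LInfty := ofFinsupp (.single k 1)

theorem basisVec_apply_self (k : ℕ) : basisVec k k = 1 := by
  simp [basisVec, ofFinsupp_apply]

theorem basisVec_apply_of_ne {k m : ℕ} (h : m ≠ k) : basisVec k m = 0 := by
  simp [basisVec, ofFinsupp_apply, h]

theorem norm_basisVec (k : ℕ) : ‖basisVec k‖ = 1 := by
  refine le_antisymm (lp.norm_le_of_forall_le zero_le_one fun m => ?_) ?_
  · rcases eq_or_ne m k with rfl | h
    · rw [basisVec_apply_self, norm_one]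
    · rw [basisVec_apply_of_ne h, norm_zero]
      exact zero_le_one
  · simpa [basisVec_apply_self] using lp.norm_apply_le_norm ENNReal.top_ne_zero (basisVec k) k

theorem range_ofFinsupp : LinearMap.range ofFinsupp = Submodule.span ℂ (Set.range basisVec) := by
  rw [LinearMap.range_eq_map, ← Finsupp.basisSingleOne.span_eq, Submodule.map_span,
    ← Set.range_comp, Finsupp.coe_basisSingleOne]
  rfl

/-- The subspace of `ℓ∞` of the sequences vanishing off `M`, a copy of `ℓ∞(M)`. -/
def supported (M : Set ℕ) : Submodule ℂ LInfty where
  carrier := {v | Function.support v ⊆ M}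
  zero_mem' := by simp
  add_mem' {u v} hu hv := (Function.support_add u v).trans (Set.union_subset hu hv)
  smul_mem' c v hv := (Function.support_const_smul_subset c v).trans hv

theorem supported_mono {M N : Set ℕ} (h : M ⊆ N) : supported M ≤ supported N :=
  fun _ hv => hv.trans h

theorem basisVec_mem_supported {M : Set ℕ} {k : ℕ} (hk : k ∈ M) : basisVec k ∈ supported M := by
  intro m hm
  rcases eq_or_ne m k with rfl | h
  · exact hk
  · exact absurd (basisVec_apply_of_ne h) hm

theorem exists_sub_mem_range_ofFinsupp_eq_indicator (v : LInfty) {F : Set ℕ} (hF : F.Finite) :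
    ∃ w : LInfty, v - w ∈ LinearMap.range ofFinsupp ∧ ⇑w = Fᶜ.indicator v := by
  classical
  let c : ℕ →₀ ℂ := Finsupp.indicator hF.toFinset fun m _ => v m
  refine ⟨v - ofFinsupp c, ⟨c, (sub_sub_cancel _ _).symm⟩, ?_⟩
  ext m
  by_cases hm : m ∈ F <;> simp [c, hm, ofFinsupp_apply]

theorem norm_sum_le_of_pairwise_disjoint_support {T : Type*} [Fintype T] {y : T → LInfty} {C : ℝ}
    (hC : 0 ≤ C) (hy : ∀ t, ‖y t‖ ≤ C)
    (hdisj : Pairwise fun s t => Disjoint (Function.support (y s)) (Function.support (y t))) :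
    ‖∑ t, y t‖ ≤ C := by
  refine lp.norm_le_of_forall_le hC fun m => ?_
  rw [lp.coeFn_sum, Finset.sum_apply]
  rcases isEmpty_or_nonempty T with _ | _
  · simpa using hC
  · obtain ⟨s, hs⟩ := exists_forall_ne_apply_eq_zero hdisj m
    rw [Fintype.sum_eq_single s hs]
    exact (lp.norm_apply_le_norm ENNReal.top_ne_zero (y s) m).trans (hy s)

theorem exists_linearIsometry_basisVec_eq {u : ℕ → LInfty} (hu : ∀ k, ‖u k‖ = 1)
    (hdisj : Pairwise fun k l => Disjoint (Function.support (u k)) (Function.support (u l))) :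
    ∃ T : LInfty →ₗᵢ[ℂ] LInfty, (∀ k, T (basisVec k) = u k) ∧
      ∀ M, (∀ k, u k ∈ supported M) → ∀ v, T v ∈ supported M := by
  choose q hq using exists_forall_ne_apply_eq_zero hdisj
  have norm_le (v : LInfty) (m : ℕ) : ‖v (q m) * u (q m) m‖ ≤ ‖v‖ := by
    rw [norm_mul]
    refine (mul_le_of_le_one_right (norm_nonneg _) ?_).trans
      (lp.norm_apply_le_norm ENNReal.top_ne_zero v _)
    exact hu (q m) ▸ lp.norm_apply_le_norm ENNReal.top_ne_zero (u (q m)) m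
  let T : LInfty →ₗ[ℂ] LInfty :=
    { toFun v := ⟨fun m => v (q m) * u (q m) m, memℓp_infty ⟨‖v‖, by
        rintro _ ⟨m, rfl⟩
        exact norm_le v m⟩⟩
      map_add' v w := by ext m; exact add_mul _ _ _
      map_smul' c v := by ext m; exact mul_assoc _ _ _ }
  have le_norm (v : LInfty) (k : ℕ) : ‖v k‖ ≤ ‖T v‖ := calc
    ‖v k‖ = ‖v k • u k‖ := by rw [norm_smul, hu, mul_one]
    _ ≤ ‖T v‖ := lp.norm_le_of_forall_le (norm_nonneg _) fun m => by
      rcases eq_or_ne k (q m) with rfl | h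
      · exact lp.norm_apply_le_norm ENNReal.top_ne_zero (T v) m
      · simp [hq m k h]
  refine ⟨⟨T, fun v => le_antisymm ?_ ?_⟩, fun k => ?_, fun M hM v m hm => hM (q m) ?_⟩
  · exact lp.norm_le_of_forall_le (norm_nonneg _) (norm_le v)
  · exact lp.norm_le_of_forall_le (norm_nonneg _) (le_norm v)
  · ext m
    change basisVec k (q m) * u (q m) m = u k m
    rcases eq_or_ne (q m) k with rfl | h
    · rw [basisVec_apply_self, one_mul]
    · rw [basisVec_apply_of_ne h, zero_mul, hq m k h.symm]
  · exact right_ne_zero_of_mul hm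

theorem not_separableSpace : ¬ TopologicalSpace.SeparableSpace LInfty := by
  intro _
  obtain ⟨N, -, hinf, hfin⟩ := exists_infinite_subset_pairwise_finite_inter Set.infinite_univ
  let χ (t : ℝ) : LInfty := ⟨(N t).indicator 1, memℓp_infty ⟨1, by
    rintro _ ⟨m, rfl⟩
    simpa using norm_indicator_le_norm_self (1 : ℕ → ℂ) m⟩⟩
  have hdist {s t : ℝ} (hst : s ≠ t) : 1 ≤ ‖χ s - χ t‖ := by
    obtain ⟨m, hms, hmt⟩ := ((hinf s).sdiff (hfin hst)).nonempty
    replace hmt : m ∉ N t := fun h => hmt ⟨hms, h⟩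
    calc 1 = ‖(χ s - χ t) m‖ := by
          rw [lp.coeFn_sub, Pi.sub_apply]
          simp [χ, hms, hmt]
      _ ≤ ‖χ s - χ t‖ := lp.norm_apply_le_norm ENNReal.top_ne_zero _ m
  have hdisj : Set.univ.PairwiseDisjoint fun t => Metric.ball (χ t) (1 / 2) := fun s _ t _ hst =>
    Metric.ball_disjoint_ball (by rw [add_halves, dist_eq_norm]; exact hdist hst)
  refine Set.not_countable_univ (α := ℝ) (hdisj.countable_of_isOpen
    (fun _ _ => Metric.isOpen_ball) fun _ _ => Metric.nonempty_ball.2 one_half_pos)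

theorem sum_norm_map_sq_le_of_pairwise_disjoint_support {n : ℕ} {T : Type*} [Fintype T]
    (B : LInfty [×(n + 1)]→L[ℂ] ℂ) {x : T → Fin (n + 1) → LInfty} (hx : ∀ t, ‖x t‖ ≤ 1)
    (hdisj : ∀ i, Pairwise fun s t =>
      Disjoint (Function.support (x s i)) (Function.support (x t i))) :
    ∑ t, ‖B (x t)‖ ^ 2 ≤ ‖B‖ ^ 2 := by
  obtain ⟨θ, hθ, hle⟩ :=
    exists_norm_eq_one_sum_map_norm_sq_le B.toMultilinearMap fun i t => x t i
  have hnorm (i : Fin (n + 1)) : ‖∑ t, θ i t • x t i‖ ≤ 1 := by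
    refine norm_sum_le_of_pairwise_disjoint_support zero_le_one (fun t => ?_) fun s t hst => ?_
    · rw [norm_smul, hθ, one_mul]
      exact (norm_le_pi_norm (x t) i).trans (hx t)
    · exact (hdisj i hst).mono (Function.support_const_smul_subset _ _)
        (Function.support_const_smul_subset _ _)
  calc ∑ t, ‖B (x t)‖ ^ 2
      ≤ ∑ r : Fin (n + 1) → T, ‖B fun i => x (r i) i‖ ^ 2 :=
        (Finset.sum_map Finset.univ ⟨Function.const _, Function.const_injective⟩ fun r =>
          ‖B fun i => x (r i) i‖ ^ 2).symm.trans_le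
          (Finset.sum_le_univ_sum_of_nonneg fun r => by positivity)
    _ ≤ ‖B fun i => ∑ t, θ i t • x t i‖ ^ 2 := hle
    _ ≤ ‖B‖ ^ 2 := by
        gcongr
        exact B.unit_le_opNorm ((pi_norm_le_iff_of_nonneg zero_le_one).2 hnorm)

theorem sum_norm_map_sq_le_of_pairwise_finite_inter {n : ℕ} {T : Type*} [Fintype T]
    (B : LInfty [×(n + 1)]→L[ℂ] ℂ) {N : T → Set ℕ}
    (hN : Pairwise fun s t => (N s ∩ N t).Finite)
    (hB : ∀ t v, (∀ i, v i ∈ supported (N t)) → (∃ i, v i ∈ LinearMap.range ofFinsupp) → B v = 0)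
    {x : T → Fin (n + 1) → LInfty} (hx : ∀ t, ‖x t‖ ≤ 1) (hxN : ∀ t i, x t i ∈ supported (N t)) :
    ∑ t, ‖B (x t)‖ ^ 2 ≤ ‖B‖ ^ 2 := by
  let F : Set ℕ := ⋃ (s : T) (t : T) (_ : s ≠ t), N s ∩ N t
  have hF : F.Finite := Set.finite_iUnion fun s => Set.finite_iUnion fun t =>
    Set.finite_iUnion fun h => hN h
  choose y hxy hy using fun t i => exists_sub_mem_range_ofFinsupp_eq_indicator (x t i) hF
  have hyN (t i) : Function.support (y t i) ⊆ N t \ F := by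
    rw [hy, Set.support_indicator, Set.inter_comm, Set.sdiff_eq]
    exact Set.inter_subset_inter_left _ (hxN t i)
  have hmap (t : T) : B (x t) = B (y t) := by
    refine map_eq_map_of_sub_mem B.toMultilinearMap (hB t) (hxN t) (fun i => ?_) (hxy t)
    exact (hyN t i).trans Set.sdiff_subset
  simp only [hmap]
  refine sum_norm_map_sq_le_of_pairwise_disjoint_support B (fun t => ?_) fun i s t hst => ?_
  · refine (pi_norm_le_iff_of_nonneg zero_le_one).2 fun i =>
      lp.norm_le_of_forall_le zero_le_one fun m => ?_
    rw [hy]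
    exact (norm_indicator_le_norm_self _ _).trans <|
      (lp.norm_apply_le_norm ENNReal.top_ne_zero (x t i) m).trans <|
        (norm_le_pi_norm (x t) i).trans (hx t)
  · refine Set.disjoint_of_subset (hyN s i) (hyN t i) (Set.disjoint_left.2 fun m hms hmt => ?_)
    exact hms.2 (Set.mem_iUnion₂.2 ⟨s, t, Set.mem_iUnion.2 ⟨hst, hms.1, hmt.1⟩⟩)

theorem countable_setOf_exists_map_ne_zero {n : ℕ} {T : Type*} (B : LInfty [×(n + 1)]→L[ℂ] ℂ)
    {N : T → Set ℕ} (hN : Pairwise fun s t => (N s ∩ N t).Finite)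
    (hB : ∀ t v, (∀ i, v i ∈ supported (N t)) → (∃ i, v i ∈ LinearMap.range ofFinsupp) →
      B v = 0) :
    {t | ∃ v, (∀ i, v i ∈ supported (N t)) ∧ B v ≠ 0}.Countable := by
  set S := {t | ∃ v, (∀ i, v i ∈ supported (N t)) ∧ B v ≠ 0}
  have hunit (t : S) : ∃ v, ‖v‖ ≤ 1 ∧ (∀ i, v i ∈ supported (N t)) ∧ B v ≠ 0 := by
    obtain ⟨t, v, hv, hBv⟩ := t
    have hv0 : v ≠ 0 := fun h => hBv (h ▸ B.map_zero)
    refine ⟨(‖v‖ : ℂ)⁻¹ • v, (norm_smul_inv_norm hv0).le,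
      fun i => (supported (N t)).smul_mem _ (hv i), ?_⟩
    refine (B.map_smul_univ (fun _ => (‖v‖ : ℂ)⁻¹) v).trans_ne (smul_ne_zero ?_ hBv)
    simpa using hv0
  choose x hx hxN hBx using hunit
  have hsum : Summable fun t => ‖B (x t)‖ ^ 2 := summable_of_sum_le (fun t => by positivity)
    fun J => by
      rw [← Finset.sum_coe_sort]
      exact sum_norm_map_sq_le_of_pairwise_finite_inter B (N := fun t : J => N t)
        (fun s t hst => hN fun h => hst (Subtype.ext (Subtype.ext h)))
        (fun t => hB t) (fun t => hx t) fun t => hxN t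
  have := hsum.countable_support
  rwa [Function.support_eq_univ fun t => pow_ne_zero 2 (norm_ne_zero_iff.2 (hBx t)),
    Set.countable_univ_iff] at this

theorem exists_infinite_forall_map_eq_zero {n : ℕ} {J : Type*} [Countable J]
    (A : J → LInfty [×n]→L[ℂ] ℂ) (hA : ∀ j (r : Fin n → ℕ), A j (fun i => basisVec (r i)) = 0) :
    ∃ M : Set ℕ, M.Infinite ∧ ∀ j v, (∀ i, v i ∈ supported M) → A j v = 0 := by
  induction n generalizing J with
  | zero => exact ⟨Set.univ, Set.infinite_univ, fun j v _ => by
      rw [← hA j Fin.elim0, Subsingleton.elim v]⟩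
  | succ n ih =>
    obtain ⟨M, hM, hzero⟩ := ih
      (fun p : J × Fin (n + 1) × ℕ => (A p.1).curryMid p.2.1 (basisVec p.2.2))
      fun ⟨j, i, k⟩ r => by
        rw [ContinuousMultilinearMap.curryMid_apply, ← hA j (i.insertNth k r)]
        congr 1
        ext1 l
        induction l using i.succAboveCases with
        | x => simp
        | p l => simp
    have hfin (j : J) (v : Fin (n + 1) → LInfty) (hv : ∀ i, v i ∈ supported M)
        (hex : ∃ i, v i ∈ LinearMap.range ofFinsupp) : A j v = 0 := by
      obtain ⟨i, hi⟩ := hex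
      suffices ∀ c ∈ LinearMap.range ofFinsupp, (A j).curryMid i c (i.removeNth v) = 0 by
        simpa [ContinuousMultilinearMap.curryMid_apply] using this (v i) hi
      rw [range_ofFinsupp]
      intro c hc
      induction hc using Submodule.span_induction with
      | mem c hc =>
        obtain ⟨k, rfl⟩ := hc
        exact hzero (j, i, k) (i.removeNth v) fun l => hv _
      | zero => simp
      | add c d _ _ hc hd => rw [map_add, add_apply, hc, hd, add_zero]
      | smul a c _ hc => rw [map_smul, smul_apply, hc, smul_zero]
    obtain ⟨N, hNM, hNinf, hNfin⟩ := exists_infinite_subset_pairwise_finite_inter hM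
    have hbad : (⋃ j, {t | ∃ v, (∀ i, v i ∈ supported (N t)) ∧ A j v ≠ 0}).Countable :=
      Set.countable_iUnion fun j => countable_setOf_exists_map_ne_zero (A j) hNfin
        fun t v hv => hfin j v fun i => supported_mono (hNM t) (hv i)
    obtain ⟨t, ht⟩ := (hbad.dense_compl ℝ).nonempty
    refine ⟨N t, hNinf t, fun j v hv => ?_⟩
    by_contra hne
    exact ht (Set.mem_iUnion.2 ⟨j, v, hv, hne⟩)

theorem exists_norm_eq_one_pairwise_disjoint_support_forall_map_eq_zero {ι : Type*} [Finite ι]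
    [Nonempty ι] (A : MultilinearMap ℂ (fun _ : ι => LInfty) ℂ) :
    ∃ u : ℕ → LInfty, (∀ k, ‖u k‖ = 1) ∧
      (Pairwise fun k l => Disjoint (Function.support (u k)) (Function.support (u l))) ∧
      ∀ r : ι → ℕ, A (fun i => u (r i)) = 0 := by
  have := Fintype.ofFinite ι
  obtain ⟨w, hw, hdisj, hA⟩ := exists_pairwise_disjoint_support_forall_map_eq_zero
    (A.compLinearMap fun _ => ofFinsupp)
  have hne (k : ℕ) : ofFinsupp (w k) ≠ 0 := fun h =>
    hw k (Finsupp.ext fun m => by rw [← ofFinsupp_apply, h]; rfl)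
  refine ⟨fun k => (‖ofFinsupp (w k)‖ : ℂ)⁻¹ • ofFinsupp (w k),
    fun k => norm_smul_inv_norm (hne k), fun k l hkl => ?_, fun r => ?_⟩
  · have : Disjoint (Function.support (w k)) (Function.support (w l)) := by
      rw [Finsupp.fun_support_eq, Finsupp.fun_support_eq]
      exact Finset.disjoint_coe.2 (hdisj hkl)
    exact this.mono (Function.support_const_smul_subset _ _)
      (Function.support_const_smul_subset _ _)
  · rw [A.map_smul_univ]
    exact (congrArg _ (hA r)).trans (smul_zero _)

theorem exists_linearIsometry_forall_map_eq_zero {n : ℕ} (hn : 1 ≤ n)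
    (A : LInfty [×n]→L[ℂ] ℂ) :
    ∃ T : LInfty →ₗᵢ[ℂ] LInfty, ∀ v : Fin n → LInfty, A (fun i => T (v i)) = 0 := by
  have : Nonempty (Fin n) := ⟨⟨0, hn⟩⟩
  obtain ⟨u, hu, hdisj, hAu⟩ :=
    exists_norm_eq_one_pairwise_disjoint_support_forall_map_eq_zero A.toMultilinearMap
  obtain ⟨S, hS, -⟩ := exists_linearIsometry_basisVec_eq hu hdisj
  obtain ⟨M, hM, hzero⟩ := exists_infinite_forall_map_eq_zero
    (fun _ : Unit => A.compContinuousLinearMap fun _ => S.toContinuousLinearMap)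
    fun _ r => by simpa [hS] using hAu r
  obtain ⟨T, -, hT⟩ := exists_linearIsometry_basisVec_eq
    (u := fun k => basisVec (hM.natEmbedding M k)) (fun k => norm_basisVec _) fun k l hkl => by
      have hne : (hM.natEmbedding M k : ℕ) ≠ hM.natEmbedding M l := fun h =>
        hkl ((hM.natEmbedding M).injective (Subtype.ext h))
      exact (Set.disjoint_singleton.2 hne).mono (basisVec_mem_supported (Set.mem_singleton _))
        (basisVec_mem_supported (Set.mem_singleton _))
  exact ⟨S.comp T, fun v => hzero () (fun i => T (v i)) fun i =>
    hT M (fun k => basisVec_mem_supported (hM.natEmbedding M k).2) (v i)⟩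

end LInfty

theorem theorem27 (n : ℕ) (hn : 1 ≤ n) (P : LInfty → ℂ)
    (hP : IsContHomogeneousPolynomial n P) :
    ∃ H : Submodule ℂ LInfty,
      (∀ x ∈ H, P x = 0) ∧
      Nonempty (LInfty ≃L[ℂ] H) ∧
      ¬ TopologicalSpace.SeparableSpace H := by
  obtain ⟨⟨A, hsymm, hPA⟩, k, hk⟩ := hP
  have hcont : Continuous A := continuous_of_norm_map_const_le A hsymm (k := k) fun x => by
    rw [← hPA, Fintype.card_fin]
    exact hk x
  obtain ⟨T, hT⟩ := LInfty.exists_linearIsometry_forall_map_eq_zero hn ⟨A, hcont⟩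
  let e : LInfty ≃L[ℂ] LinearMap.range T.toLinearMap := T.equivRange.toContinuousLinearEquiv
  refine ⟨LinearMap.range T.toLinearMap, ?_, ⟨e⟩, fun _ => LInfty.not_separableSpace ?_⟩
  · rintro _ ⟨x, rfl⟩
    rw [hPA]
    exact hT fun _ => x
  · exact e.symm.surjective.denseRange.separableSpace e.symm.continuous
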